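/- Let $\Gamma$ be any contour in the complex plane that runs from $\infty\cdot e^{5\pi i/6}$ to $\infty\cdot e^{\pi i/6}$, that is, a curve $\gamma:\mathbb R\to\mathbb C$ (piecewise $C^1$, or more generally continuous, differentiable outside a countable set, with locally integrable derivative) such that $|\gamma(t)|\to\infty$ as $t\to\pm\infty$, $\gamma(t)/|\gamma(t)|\to e^{5\pi i/6}$ as $t\to-\infty$ and $\gamma(t)/|\gamma(t)|\to e^{\pi i/6}$ as $t\to+\infty$. Let $\delta\in\mathbb R$. Then the moments $$\mu_k=\int_\Gamma z^k e^{i\left(\frac{z^3}{3}-\delta z\right)}\,dz,\qquad k=0,1,2,\ldots,$$ converge (as improper integrals $\lim_{a\to-\infty,\,b\to+\infty}\int_a^b(\cdot)\,\gamma'(t)\,dt$), and for every integer $n\ge 0$ the Hankel determinant $$h_{2n}=\det\left[\mu_{j+k}\right]_{j,k=0}^{2n-1}$$ is nonzero (with $h_0=1$). Consequently, for every integer $n\ge 0$ and every real $\delta$ there is exactly one monic polynomial $p_{2n,\delta}$ of degree $2n$ with $$\int_\Gamma p_{2n,\delta}(z)\,z^k e^{i\left(\frac{z^3}{3}-\delta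 z\right)}\,dz=0,\qquad k=0,\ldots,2n-1.$$ -/

import Mathlib

open Filter Topology MeasureTheory

/-- `γ : ℝ → ℂ` parametrizes a contour going from `∞ · e^{5πi/6}` to `∞ · e^{πi/6}`.
The regularity fields hold for every piecewise `C¹` path (with locally finitely many corners). -/
structure IsAiryContour (γ : ℝ → ℂ) : Prop where
  continuous : Continuous γ
  differentiable : ∃ s : Set ℝ, s.Countable ∧ ∀ t, t ∉ s → DifferentiableAt ℝ γ t
  deriv_locallyIntegrable : LocallyIntegrable (deriv γ) volume
  norm_atBot : Tendsto (fun t => ‖γ t‖) atBot atTop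
  norm_atTop : Tendsto (fun t => ‖γ t‖) atTop atTop
  direction_atBot : Tendsto (fun t => γ t / (‖γ t‖ : ℂ)) atBot
    (𝓝 (Complex.exp (5 * Complex.I * (Real.pi : ℂ) / 6)))
  direction_atTop : Tendsto (fun t => γ t / (‖γ t‖ : ℂ)) atTop
    (𝓝 (Complex.exp (Complex.I * (Real.pi : ℂ) / 6)))

/-- The contour integral `∫_γ f(z) dz` along a doubly infinite path converges, with value `I`:
the integrals over `γ` restricted to `[a, b]` tend to `I` as `a → -∞` and `b → +∞` independently. -/
def HasContourIntegral (γ : ℝ → ℂ) (f : ℂ → ℂ) (I : ℂ) : Prop :=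
  Tendsto (fun p : ℝ × ℝ => ∫ t in p.1..p.2, f (γ t) * deriv γ t) (atBot ×ˢ atTop) (𝓝 I)

/-- The value of the contour integral `∫_γ f(z) dz` (meaningful when it converges). -/
noncomputable def contourIntegral (γ : ℝ → ℂ) (f : ℂ → ℂ) : ℂ :=
  limUnder (atBot ×ˢ atTop) (fun p : ℝ × ℝ => ∫ t in p.1..p.2, f (γ t) * deriv γ t)

/-- The weight function `e^{i (z³/3 - δ z)}`. -/
noncomputable def airyWeight (δ : ℝ) (z : ℂ) : ℂ :=
  Complex.exp (Complex.I * (z ^ 3 / 3 - (δ : ℂ) * z))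

/-- The moments `μ_k = ∫_γ z^k e^{i (z³/3 - δ z)} dz`. -/
noncomputable def airyMoment (γ : ℝ → ℂ) (δ : ℝ) (k : ℕ) : ℂ :=
  contourIntegral γ (fun z => z ^ k * airyWeight δ z)

/-- The `n × n` Hankel matrix `(μ_{j+k})_{0 ≤ j, k ≤ n-1}`. -/
noncomputable def airyHankelMatrix (γ : ℝ → ℂ) (δ : ℝ) (n : ℕ) : Matrix (Fin n) (Fin n) ℂ :=
  Matrix.of fun j k => airyMoment γ δ ((j : ℕ) + (k : ℕ))

/-- The Hankel determinant `h_n`. -/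
noncomputable def airyHankelDet (γ : ℝ → ℂ) (δ : ℝ) (n : ℕ) : ℂ :=
  (airyHankelMatrix γ δ n).det

/-- `p` is a monic polynomial of degree `n` with `∫_γ p(z) z^k e^{i (z³/3 - δ z)} dz = 0`
for `k = 0, …, n - 1`. -/
def IsMonicOrthogonal (γ : ℝ → ℂ) (δ : ℝ) (n : ℕ) (p : Polynomial ℂ) : Prop :=
  p.Monic ∧ p.natDegree = n ∧
    ∀ k < n, HasContourIntegral γ (fun z => p.eval z * z ^ k * airyWeight δ z) 0

/-!
The weight decays like a Gaussian in the region between the line `Im z = 1` and the rays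
`Im z = |Re z|`, which contains the two asymptotic directions of the contour. A primitive of the
integrand therefore has the same limits along the contour as along the line, so all contour
integrals converge and equal absolutely convergent integrals over the line
(`hasContourIntegral_eval_mul_airyExp`). In particular `μ_k = (-i)^k F_k(-δ)`, where
`F_k = 2π Ai^{(k)}` (`airyDeriv`), and it remains to show that the Hankel matrix of the real numbers
`F_{j+k}(x)`, `j, k < 2n`, has trivial kernel for every real `x` (`airyHankel_kernel`).

By the Airy equation `Ai^{(k)} = a_k Ai + b_k Ai'` with polynomials of degrees at most `k / 2` and
`(k - 1) / 2`. A kernel vector `p` is thus a pair of polynomials `A`, `B` of degree less than `n`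
such that `A(y) Ai(x + y) + B(y) Ai'(x + y) = O(y^{2n})`, that is, a degenerate Padé approximant of
`Ai' / Ai` at `x`. The Airy kernel
`K(u, v) = (Ai(x+u) Ai'(x+v) - Ai'(x+u) Ai(x+v)) / (u - v) = ∫_x^∞ Ai(t+u) Ai(t+v) dt` excludes
this. Take the case `Ai'(x) ≠ 0`, the other one being symmetric, and let `a(y) = A(y) / Ai'(x + y)`.
Up to high order `a(u) a(v) K(u, v)` is the Bezoutian `(A(u) B(v) - B(u) A(v)) / (u - v)`, which has
degree at most `n - 2` in each variable, so the coefficient of `u^{n-1} v^{n-1}` vanishes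
(`coeff_coeff_mul_kernel_eq_zero`). This coefficient is also
`∫_x^∞ (∑_j c_j Ai^{(j)}(t))² dt`, with `c_j` a nonzero multiple of the coefficient of `y^{n-1-j}`
in `a`. Hence all `c_j` are zero, which gives `A = B = 0`.

Both the definiteness of this integral as a quadratic form in `c` and the return from `A = B = 0` to
`p = 0` use that no nonzero polynomial in
`d/dx` annihilates `Ai` (`eq_zero_of_forall_airyFunctional_mul_eq_zero`), which comes down to `Ai`
and `Ai'` having no common zero.
-/

/-! ### The Airy exponential and its decay -/

/-- The exponential `e^{i (z³/3 + x z)}` of the Airy integral, for complex `x`; the weight of the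
theorem is the case `x = -δ`. -/
noncomputable def airyExp (x z : ℂ) : ℂ :=
  Complex.exp (Complex.I * (z ^ 3 / 3 + x * z))

lemma airyWeight_eq_airyExp (δ : ℝ) (z : ℂ) : airyWeight δ z = airyExp (-δ : ℝ) z := by
  simp only [airyWeight, airyExp]
  congr 2
  push_cast
  ring

lemma hasDerivAt_airyExp (x z : ℂ) :
    HasDerivAt (airyExp x) (Complex.I * (z ^ 2 + x) * airyExp x z) z := by
  have h : HasDerivAt (fun w : ℂ => Complex.I * (w ^ 3 / 3 + x * w))
      (Complex.I * (z ^ 2 + x)) z := by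
    have := ((((hasDerivAt_id z).pow 3).div_const 3).add
      ((hasDerivAt_id z).const_mul x)).const_mul Complex.I
    refine this.congr_deriv ?_
    simp
  have h2 := h.cexp
  rw [mul_comm] at h2
  exact h2

lemma hasDerivAt_airyExp_param (x z : ℂ) :
    HasDerivAt (fun y => airyExp y z) (Complex.I * z * airyExp x z) x := by
  have h : HasDerivAt (fun y : ℂ => Complex.I * (z ^ 3 / 3 + y * z)) (Complex.I * z) x := by
    have := (((hasDerivAt_id x).mul_const z).const_add (z ^ 3 / 3)).const_mul Complex.I
    refine this.congr_deriv ?_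
    simp
  have h2 := h.cexp
  rw [mul_comm] at h2
  exact h2

lemma differentiable_airyExp (x : ℂ) : Differentiable ℂ (airyExp x) :=
  fun z => (hasDerivAt_airyExp x z).differentiableAt

lemma norm_airyExp_le (x z : ℂ) :
    ‖airyExp x z‖ ≤ Real.exp (-(z.re ^ 2 * z.im - z.im ^ 3 / 3) + ‖x‖ * ‖z‖) := by
  rw [airyExp, Complex.norm_exp, Real.exp_le_exp, mul_add, Complex.add_re]
  have h1 : (Complex.I * (z ^ 3 / 3)).re = -(z.re ^ 2 * z.im - z.im ^ 3 / 3) := by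
    obtain ⟨a, b⟩ := z
    have h : Complex.I * ((⟨a, b⟩ : ℂ) ^ 3 / 3) = Complex.I * (⟨a, b⟩ : ℂ) ^ 3 * ((1 / 3 : ℝ) : ℂ) := by
      push_cast; ring
    rw [h, Complex.re_mul_ofReal]
    simp [pow_succ]
    ring
  have h2 : (Complex.I * (x * z)).re ≤ ‖x‖ * ‖z‖ := by
    refine (Complex.re_le_norm _).trans ?_
    simp
  linarith

lemma exists_norm_eval_le_exp (P : Polynomial ℂ) :
    ∃ C, 0 ≤ C ∧ ∀ z : ℂ, ‖P.eval z‖ ≤ C * Real.exp ‖z‖ := by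
  induction P using Polynomial.induction_on' with
  | add p q hp hq =>
    obtain ⟨C, hC, h⟩ := hp
    obtain ⟨D, hD, h'⟩ := hq
    refine ⟨C + D, by positivity, fun z => ?_⟩
    rw [Polynomial.eval_add, add_mul]
    exact (norm_add_le _ _).trans (add_le_add (h z) (h' z))
  | monomial n a =>
    refine ⟨‖a‖ * n.factorial, by positivity, fun z => ?_⟩
    rw [Polynomial.eval_monomial, norm_mul, norm_pow, mul_assoc]
    gcongr
    have := Real.pow_div_factorial_le_exp ‖z‖ (norm_nonneg z) n
    rw [div_le_iff₀ (by positivity)] at this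
    linarith

/-- Gaussian decay of `P(z) e^{i (z³/3 + x z)}`, uniform for bounded `x`, on the part of the upper
half-plane that lies between the line `Im z = 1` and the rays `Im z = |Re z|`. Both the line and
the directions `e^{iπ/6}`, `e^{5πi/6}` are inside. -/
lemma exists_norm_eval_mul_airyExp_le (P : Polynomial ℂ) (R : ℝ) :
    ∃ C, 0 ≤ C ∧ ∀ x z : ℂ, ‖x‖ ≤ R → 1 ≤ z.im → (z.im = 1 ∨ z.im ≤ |z.re|) →
      ‖P.eval z * airyExp x z‖ ≤ C * Real.exp (-(1 / 2) * z.re ^ 2) := by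
  obtain ⟨C, hC, h⟩ := exists_norm_eval_le_exp P
  refine ⟨C * Real.exp (1 + |R| + 1 / 3 + 6 * (1 + |R|) ^ 2), by positivity, fun x z hx h1 h2 => ?_⟩
  rw [norm_mul]
  calc ‖P.eval z‖ * ‖airyExp x z‖
      ≤ (C * Real.exp ‖z‖) * Real.exp (-(z.re ^ 2 * z.im - z.im ^ 3 / 3) + ‖x‖ * ‖z‖) :=
        mul_le_mul (h z) (norm_airyExp_le x z) (norm_nonneg _) (by positivity)
    _ = C * Real.exp (‖z‖ + (-(z.re ^ 2 * z.im - z.im ^ 3 / 3) + ‖x‖ * ‖z‖)) := by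
        rw [mul_assoc, ← Real.exp_add]
    _ ≤ C * Real.exp ((1 + |R| + 1 / 3 + 6 * (1 + |R|) ^ 2) + (-(1 / 2) * z.re ^ 2)) := by
        refine mul_le_mul_of_nonneg_left (Real.exp_le_exp.2 ?_) hC
        have hR : 0 ≤ |R| := abs_nonneg R
        have hxR : ‖x‖ * ‖z‖ ≤ |R| * ‖z‖ := by
          gcongr
          exact hx.trans (le_abs_self R)
        have hs := sq_abs z.re
        have hs0 := abs_nonneg z.re
        have hz : ‖z‖ ≤ 2 * |z.re| + 1 := by
          have := Complex.norm_le_abs_re_add_abs_im z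
          rw [abs_of_nonneg (by linarith : 0 ≤ z.im)] at this
          rcases h2 with h2 | h2 <;> linarith
        have hcub : 2 / 3 * z.re ^ 2 - 1 / 3 ≤ z.re ^ 2 * z.im - z.im ^ 3 / 3 := by
          rcases h2 with h2 | h2
          · rw [h2]; nlinarith [sq_nonneg z.re]
          · have h3 : z.im ^ 2 ≤ z.re ^ 2 := by
              rw [← hs]; exact pow_le_pow_left₀ (by linarith) h2 2
            nlinarith [mul_nonneg (by linarith : (0 : ℝ) ≤ z.im) (sub_nonneg.2 h3),
              mul_nonneg (by linarith : (0 : ℝ) ≤ z.im - 1) (sq_nonneg z.re)]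
        have hmul : (1 + |R|) * ‖z‖ ≤ (1 + |R|) * (2 * |z.re| + 1) := by gcongr
        nlinarith [sq_nonneg (|z.re| - 6 * (1 + |R|))]
    _ = _ := by rw [Real.exp_add]; ring

/-! ### Integration along the line `Im z = 1` -/

/-- The point `s + i` of the line `Im z = 1`. -/
noncomputable def linePoint (s : ℝ) : ℂ := s + Complex.I

@[simp] lemma linePoint_re (s : ℝ) : (linePoint s).re = s := by simp [linePoint]

@[simp] lemma linePoint_im (s : ℝ) : (linePoint s).im = 1 := by simp [linePoint]

lemma hasDerivAt_linePoint (s : ℝ) : HasDerivAt linePoint 1 s :=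
  Complex.ofRealCLM.hasDerivAt.add_const _

lemma continuous_linePoint : Continuous linePoint := by
  unfold linePoint; fun_prop

lemma integrable_eval_mul_airyExp (P : Polynomial ℂ) (x : ℂ) :
    Integrable (fun s => P.eval (linePoint s) * airyExp x (linePoint s)) := by
  obtain ⟨C, -, h⟩ := exists_norm_eval_mul_airyExp_le P ‖x‖
  refine Integrable.mono' ((integrable_exp_neg_mul_sq (by norm_num : (0 : ℝ) < 1 / 2)).const_mul C)
    ?_ (Eventually.of_forall fun s => ?_)
  · exact ((P.continuous.comp continuous_linePoint).mul
      ((differentiable_airyExp x).continuous.comp continuous_linePoint)).aestronglyMeasurable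
  · simpa using h x (linePoint s) le_rfl (by simp) (by simp)

/-! ### Deformation of the contour to the line -/

/-- A primitive `E` of the integrand changes by a quantity tending to zero along the vertical
segment from `z` to the line `Im z = 1`. -/
lemma tendsto_primitive_sub {ι : Type*} {l : Filter ι} (P : Polynomial ℂ) (x : ℂ) {E : ℂ → ℂ}
    (hE : ∀ z, HasDerivAt E (P.eval z * airyExp x z) z) {g : ι → ℂ}
    (hre : Tendsto (fun i => |(g i).re|) l atTop) (him1 : ∀ᶠ i in l, 1 ≤ (g i).im)
    (him2 : ∀ᶠ i in l, (g i).im ≤ |(g i).re|) :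
    Tendsto (fun i => E (g i) - E (linePoint (g i).re)) l (𝓝 0) := by
  obtain ⟨C, hC, h⟩ := exists_norm_eval_mul_airyExp_le P ‖x‖
  have hlim : Tendsto (fun r : ℝ => C * (r ^ 2 * Real.exp (-(r ^ 2 / 2)))) atTop (𝓝 0) := by
    have h1 : Tendsto (fun r : ℝ => r ^ 2 / 2) atTop atTop :=
      (tendsto_pow_atTop two_ne_zero).atTop_div_const (by norm_num)
    have h2 := ((Real.tendsto_pow_mul_exp_neg_atTop_nhds_zero 1).comp h1).const_mul (2 * C)
    rw [mul_zero] at h2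
    refine h2.congr fun r => ?_
    simp only [Function.comp, pow_one]
    ring
  refine squeeze_zero_norm' ?_ (hlim.comp hre)
  filter_upwards [him1, him2, hre.eventually_ge_atTop 1] with i h1 h2 h3
  set z := g i with hz
  set S : Set ℂ := {w | w.re = z.re ∧ 1 ≤ w.im ∧ w.im ≤ z.im} with hS
  have hconv : Convex ℝ S := by
    intro u hu v hv a b ha hb hab
    obtain ⟨hu1, hu2, hu3⟩ := hu
    obtain ⟨hv1, hv2, hv3⟩ := hv
    simp only [hS, Set.mem_ofPred_eq, Complex.add_re, Complex.real_smul, Complex.re_ofReal_mul,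
      Complex.add_im, Complex.im_ofReal_mul]
    refine ⟨by rw [hu1, hv1, ← add_mul, hab, one_mul], by nlinarith, by nlinarith⟩
  have hmv := hconv.norm_image_sub_le_of_norm_hasDerivWithin_le (f := E)
    (x := linePoint z.re) (y := z) (C := C * Real.exp (-(1 / 2) * z.re ^ 2))
    (fun w _ => (hE w).hasDerivWithinAt)
    (fun w hw => by
      have := h x w le_rfl hw.2.1 (Or.inr (by rw [hw.1]; linarith [hw.2.2]))
      rwa [hw.1] at this)
    ⟨by simp, by simp, by simpa using h1⟩ ⟨rfl, h1, le_rfl⟩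
  refine hmv.trans ?_
  have hd : ‖z - linePoint z.re‖ ≤ |z.re| ^ 2 := by
    have hzz : z - linePoint z.re = ((z.im - 1 : ℝ) : ℂ) * Complex.I := by
      apply Complex.ext <;> simp
    rw [hzz, norm_mul, Complex.norm_I, mul_one, Complex.norm_real, Real.norm_eq_abs,
      abs_of_nonneg (by linarith)]
    nlinarith
  simp only [Function.comp, sq_abs]
  rw [sq_abs] at hd
  have he : Real.exp (-(1 / 2) * z.re ^ 2) = Real.exp (-(z.re ^ 2 / 2)) := by congr 1; ring
  rw [he]
  calc C * Real.exp (-(z.re ^ 2 / 2)) * ‖z - linePoint z.re‖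
      ≤ C * Real.exp (-(z.re ^ 2 / 2)) * z.re ^ 2 := by gcongr
    _ = _ := by ring

/-- A curve that tends to infinity in a direction `c` with `0 < Im c < |Re c|` ends up in the
region where the integrand has Gaussian decay. -/
lemma eventually_mem_decay_region {l : Filter ℝ} {γ : ℝ → ℂ} {c : ℂ}
    (hn : Tendsto (fun t => ‖γ t‖) l atTop)
    (hd : Tendsto (fun t => γ t / (‖γ t‖ : ℂ)) l (𝓝 c)) (hc0 : 0 < c.im) (hc : c.im < |c.re|) :
    Tendsto (fun t => |(γ t).re|) l atTop ∧ (∀ᶠ t in l, 1 ≤ (γ t).im) ∧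
      ∀ᶠ t in l, (γ t).im ≤ |(γ t).re| := by
  have hre : Tendsto (fun t => (γ t).re / ‖γ t‖) l (𝓝 c.re) := by
    have := (Complex.continuous_re.tendsto c).comp hd
    simpa [Function.comp_def, Complex.div_ofReal_re] using this
  have him : Tendsto (fun t => (γ t).im / ‖γ t‖) l (𝓝 c.im) := by
    have := (Complex.continuous_im.tendsto c).comp hd
    simpa [Function.comp_def, Complex.div_ofReal_im] using this
  refine ⟨?_, ?_, ?_⟩
  · have h := hn.atTop_mul_pos (lt_trans hc0 hc) hre.abs
    refine h.congr' ?_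
    filter_upwards [hn.eventually_gt_atTop 0] with t ht
    rw [abs_div, abs_norm]
    field_simp
  · have h := hn.atTop_mul_pos hc0 him
    filter_upwards [hn.eventually_gt_atTop 0, h.eventually_ge_atTop 1] with t ht h1
    rwa [mul_div_cancel₀ _ ht.ne'] at h1
  · filter_upwards [hn.eventually_gt_atTop 0, him.eventually_lt hre.abs hc] with t ht h1
    rw [abs_div, abs_norm, div_lt_div_iff_of_pos_right ht] at h1
    exact h1.le

/-- The contour integral of a polynomial times the Airy exponential equals the absolutely
convergent integral along the line `Im z = 1`. -/
lemma hasContourIntegral_eval_mul_airyExp {γ : ℝ → ℂ} (hγ : IsAiryContour γ) (P : Polynomial ℂ)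
    (x : ℂ) :
    HasContourIntegral γ (fun z => P.eval z * airyExp x z)
      (∫ s, P.eval (linePoint s) * airyExp x (linePoint s)) := by
  have hdiff : Differentiable ℂ (fun z => P.eval z * airyExp x z) :=
    P.differentiable.mul (differentiable_airyExp x)
  obtain ⟨E, hE⟩ := hdiff.isExactOn_univ
  replace hE : ∀ z, HasDerivAt E (P.eval z * airyExp x z) z := fun z => hE z (Set.mem_univ z)
  have hEc : Continuous E := continuous_iff_continuousAt.2 fun z => (hE z).continuousAt
  obtain ⟨S, hS, hSd⟩ := hγ.differentiable
  have hftc (a b : ℝ) : ∫ t in a..b, (P.eval (γ t) * airyExp x (γ t)) * deriv γ t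
      = E (γ b) - E (γ a) := by
    refine integral_eq_of_hasDerivAt_off_countable (fun t => E (γ t)) _ hS
      (hEc.comp hγ.continuous).continuousOn (fun t ht => ?_) ?_
    · exact (hE (γ t)).comp t (hSd t ht.2).hasDerivAt
    · refine IntervalIntegrable.continuousOn_mul ?_
        (hdiff.continuous.comp hγ.continuous).continuousOn
      exact ⟨(hγ.deriv_locallyIntegrable.integrableOn_isCompact isCompact_Icc).mono_set
          Set.Ioc_subset_Icc_self,
        (hγ.deriv_locallyIntegrable.integrableOn_isCompact isCompact_Icc).mono_set
          Set.Ioc_subset_Icc_self⟩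
  have hline (a b : ℝ) : ∫ s in a..b, P.eval (linePoint s) * airyExp x (linePoint s)
      = E (linePoint b) - E (linePoint a) := by
    refine intervalIntegral.integral_eq_sub_of_hasDerivAt (f := fun s => E (linePoint s))
      (fun s _ => ?_) ?_
    · exact ((hE (linePoint s)).comp s (hasDerivAt_linePoint s)).congr_deriv (mul_one _)
    · exact (hdiff.continuous.comp continuous_linePoint).intervalIntegrable _ _
  -- the two asymptotic directions
  have hcp : (Complex.exp (Complex.I * (Real.pi : ℂ) / 6)) = (√3 / 2 : ℝ) + (1 / 2 : ℝ) * Complex.I := by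
    rw [show Complex.I * (Real.pi : ℂ) / 6 = ((Real.pi / 6 : ℝ) : ℂ) * Complex.I by push_cast; ring,
      Complex.exp_mul_I, ← Complex.ofReal_cos, ← Complex.ofReal_sin, Real.cos_pi_div_six,
      Real.sin_pi_div_six]
  have hcm : (Complex.exp (5 * Complex.I * (Real.pi : ℂ) / 6))
      = (-(√3 / 2) : ℝ) + (1 / 2 : ℝ) * Complex.I := by
    rw [show 5 * Complex.I * (Real.pi : ℂ) / 6 = ((Real.pi - Real.pi / 6 : ℝ) : ℂ) * Complex.I by
        push_cast; ring,
      Complex.exp_mul_I, ← Complex.ofReal_cos, ← Complex.ofReal_sin, Real.cos_pi_sub,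
      Real.sin_pi_sub, Real.cos_pi_div_six, Real.sin_pi_div_six]
  have h3 : (1 : ℝ) < √3 := by
    rw [Real.lt_sqrt (by norm_num)]; norm_num
  have hdp := hγ.direction_atTop
  have hdm := hγ.direction_atBot
  rw [hcp] at hdp
  rw [hcm] at hdm
  obtain ⟨p1, p2, p3⟩ := eventually_mem_decay_region hγ.norm_atTop hdp (by simp)
    (by
      simp only [Complex.add_re, Complex.add_im, Complex.ofReal_re, Complex.ofReal_im,
        Complex.re_ofReal_mul, Complex.im_ofReal_mul, Complex.I_re, Complex.I_im]
      rw [abs_of_nonneg (by positivity)]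
      linarith)
  obtain ⟨m1, m2, m3⟩ := eventually_mem_decay_region hγ.norm_atBot hdm (by simp)
    (by
      simp only [Complex.add_re, Complex.add_im, Complex.ofReal_re, Complex.ofReal_im,
        Complex.re_ofReal_mul, Complex.im_ofReal_mul, Complex.I_re, Complex.I_im]
      rw [mul_zero, add_zero, abs_neg, abs_of_nonneg (by positivity)]
      linarith)
  have hrep : Tendsto (fun t => (γ t).re) atTop atTop := by
    refine p1.congr' ?_
    have := (Complex.continuous_re.tendsto _).comp hdp
    filter_upwards [this.eventually_const_lt (u := 0) (by simp), hγ.norm_atTop.eventually_gt_atTop 0]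
      with t ht hn
    simp only [Function.comp, Complex.div_ofReal_re] at ht
    exact abs_of_pos ((div_pos_iff_of_pos_right hn).1 ht)
  have hrem : Tendsto (fun t => (γ t).re) atBot atBot := by
    rw [← tendsto_neg_atTop_iff]
    refine m1.congr' ?_
    have := (Complex.continuous_re.tendsto _).comp hdm
    filter_upwards [this.eventually_lt_const (u := 0) (by simp), hγ.norm_atBot.eventually_gt_atTop 0]
      with t ht hn
    simp only [Function.comp, Complex.div_ofReal_re] at ht
    exact abs_of_neg (neg_of_div_neg_left ht hn.le)
  have hl : Tendsto (fun p : ℝ × ℝ => E (linePoint (γ p.2).re) - E (linePoint (γ p.1).re))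
      (atBot ×ˢ atTop) (𝓝 (∫ s, P.eval (linePoint s) * airyExp x (linePoint s))) := by
    simp_rw [← hline]
    exact intervalIntegral_tendsto_integral (integrable_eval_mul_airyExp P x)
      (hrem.comp tendsto_fst) (hrep.comp tendsto_snd)
  have hp := (tendsto_primitive_sub P x hE p1 p2 p3).comp
    (tendsto_snd (f := (atBot : Filter ℝ)) (g := (atTop : Filter ℝ)))
  have hm := (tendsto_primitive_sub P x hE m1 m2 m3).comp
    (tendsto_fst (f := (atBot : Filter ℝ)) (g := (atTop : Filter ℝ)))
  have := (hl.add hp).sub hm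
  simp only [add_zero, sub_zero] at this
  refine this.congr fun p => ?_
  simp only [hftc, Function.comp]
  ring

/-! ### The Airy function and its derivatives -/

lemma integrable_eval_I_mul_airyExp (P : Polynomial ℂ) (x : ℂ) :
    Integrable (fun s => P.eval (Complex.I * linePoint s) * airyExp x (linePoint s)) := by
  refine (integrable_eval_mul_airyExp (P.comp (Polynomial.C Complex.I * Polynomial.X)) x).congr
    (Eventually.of_forall fun s => ?_)
  simp only [Polynomial.eval_comp, Polynomial.eval_mul, Polynomial.eval_C, Polynomial.eval_X]

/-- The linear functional `P ↦ ∫ P(iz) e^{i (z³/3 + x z)} dz` over the line `Im z = 1`. Up to the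
factor `2π` its value is `P(d/dx) Ai(x)`. -/
noncomputable def airyFunctional (x : ℂ) : Polynomial ℂ →ₗ[ℂ] ℂ where
  toFun P := ∫ s, P.eval (Complex.I * linePoint s) * airyExp x (linePoint s)
  map_add' P Q := by
    simp only [Polynomial.eval_add, add_mul]
    exact integral_add (integrable_eval_I_mul_airyExp P x) (integrable_eval_I_mul_airyExp Q x)
  map_smul' c P := by
    simp only [Polynomial.eval_smul, smul_eq_mul, mul_assoc, RingHom.id_apply]
    exact integral_const_mul _ _

lemma airyFunctional_apply (x : ℂ) (P : Polynomial ℂ) :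
    airyFunctional x P = ∫ s, P.eval (Complex.I * linePoint s) * airyExp x (linePoint s) := rfl

lemma hasDerivAt_airyFunctional (P : Polynomial ℂ) (x : ℂ) :
    HasDerivAt (fun y => airyFunctional y P) (airyFunctional x (Polynomial.X * P)) x := by
  obtain ⟨C, -, h⟩ := exists_norm_eval_mul_airyExp_le
    ((Polynomial.X * P).comp (Polynomial.C Complex.I * Polynomial.X)) (‖x‖ + 1)
  refine (hasDerivAt_integral_of_dominated_loc_of_deriv_le (μ := volume)
    (F := fun y s => P.eval (Complex.I * linePoint s) * airyExp y (linePoint s))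
    (F' := fun y s => (Polynomial.X * P).eval (Complex.I * linePoint s) * airyExp y (linePoint s))
    (bound := fun s => C * Real.exp (-(1 / 2) * s ^ 2))
    (Metric.ball_mem_nhds x one_pos) (Eventually.of_forall fun y => ?_)
    (integrable_eval_I_mul_airyExp P x) ?_ (Eventually.of_forall fun s y hy => ?_)
    ((integrable_exp_neg_mul_sq (by norm_num : (0 : ℝ) < 1 / 2)).const_mul C)
    (Eventually.of_forall fun s y _ => ?_)).2
  · exact (integrable_eval_I_mul_airyExp P y).aestronglyMeasurable
  · exact (integrable_eval_I_mul_airyExp _ x).aestronglyMeasurable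
  · have hy' : ‖y‖ ≤ ‖x‖ + 1 := by
      have h1 := norm_add_le x (y - x)
      rw [add_sub_cancel] at h1
      rw [mem_ball_iff_norm] at hy
      linarith
    simpa using h y (linePoint s) hy' (by simp) (by simp)
  · refine ((hasDerivAt_airyExp_param y (linePoint s)).const_mul
      (P.eval (Complex.I * linePoint s))).congr_deriv ?_
    simp only [Polynomial.eval_mul, Polynomial.eval_X]
    ring

/-- The Airy equation `Ai'' = x Ai`, differentiated arbitrarily often. It is the vanishing of the
integral of `d/dz (P(iz) e^{i (z³/3 + x z)})`. -/
lemma airyFunctional_X_sq_mul (P : Polynomial ℂ) (x : ℂ) :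
    airyFunctional x (Polynomial.X ^ 2 * P)
      = x * airyFunctional x P + airyFunctional x (Polynomial.derivative P) := by
  set Q : Polynomial ℂ :=
    Polynomial.C x * P + Polynomial.derivative P - Polynomial.X ^ 2 * P with hQ
  have hder (s : ℝ) : HasDerivAt
      (fun s => P.eval (Complex.I * linePoint s) * airyExp x (linePoint s))
      (Complex.I * (Q.eval (Complex.I * linePoint s) * airyExp x (linePoint s))) s := by
    have h1 : HasDerivAt (fun z : ℂ => P.eval (Complex.I * z))
        ((Polynomial.derivative P).eval (Complex.I * linePoint s) * Complex.I) (linePoint s) := by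
      have := (P.hasDerivAt (Complex.I * linePoint s)).comp (linePoint s)
        ((hasDerivAt_id (linePoint s)).const_mul Complex.I)
      exact this.congr_deriv (by simp)
    have h2 := (h1.mul (hasDerivAt_airyExp x (linePoint s))).comp s (hasDerivAt_linePoint s)
    refine h2.congr_deriv ?_
    simp only [hQ, Polynomial.eval_sub, Polynomial.eval_add, Polynomial.eval_mul,
      Polynomial.eval_C, Polynomial.eval_pow, Polynomial.eval_X, mul_pow, Complex.I_sq]
    ring
  have h0 := integral_eq_zero_of_hasDerivAt_of_integrable hder
    ((integrable_eval_I_mul_airyExp Q x).const_mul _) (integrable_eval_I_mul_airyExp P x)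
  rw [integral_const_mul] at h0
  have h1 : airyFunctional x Q = 0 :=
    (mul_eq_zero.1 h0).resolve_left Complex.I_ne_zero
  rw [hQ, map_sub, map_add, ← Polynomial.smul_eq_C_mul, map_smul, smul_eq_mul] at h1
  linear_combination -h1

/-- The Airy function and its derivative have no common zero: otherwise all derivatives would
vanish at that point, the entire function `Ai` would be zero, and so would the function
`s ↦ e^{i (s+i)³/3}`, whose Fourier transform is `Ai` up to an exponential factor. -/
lemma airyFunctional_one_or_X_ne_zero (x : ℂ) :
    airyFunctional x 1 ≠ 0 ∨ airyFunctional x Polynomial.X ≠ 0 := by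
  by_contra! hcon
  obtain ⟨h0, h1⟩ := hcon
  have hall (k : ℕ) : airyFunctional x (Polynomial.X ^ k) = 0 := by
    induction k using Nat.strong_induction_on with
    | _ k ih =>
      match k, ih with
      | 0, _ => simpa using h0
      | 1, _ => simpa using h1
      | k + 2, ih =>
        rw [add_comm, pow_add, airyFunctional_X_sq_mul, ih k (by lia), Polynomial.derivative_X_pow,
          ← Polynomial.smul_eq_C_mul, map_smul]
        cases k with
        | zero => simp
        | succ k => rw [Nat.add_sub_cancel, ih k (by lia)]; simp
  have hiter (k : ℕ) : iteratedDeriv k (fun y => airyFunctional y 1)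
      = fun y => airyFunctional y (Polynomial.X ^ k) := by
    induction k with
    | zero => simp
    | succ k ih =>
      rw [iteratedDeriv_succ, ih]
      ext y
      rw [(hasDerivAt_airyFunctional _ y).deriv, pow_succ']
  have hzero (y : ℂ) : airyFunctional y 1 = 0 := by
    have hs := Complex.hasSum_taylorSeries_of_entire
      (fun y => (hasDerivAt_airyFunctional 1 y).differentiableAt) x y
    simp only [hiter, hall, smul_zero] at hs
    exact hs.unique hasSum_zero
  set g : ℝ → ℂ := fun s => airyExp 0 (linePoint s) with hg
  have hgi : Integrable g := by simpa using integrable_eval_mul_airyExp 1 0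
  have hgc : Continuous g := (differentiable_airyExp 0).continuous.comp continuous_linePoint
  have hF : FourierTransform.fourier g = 0 := by
    ext ξ
    rw [Real.fourier_real_eq_integral_exp_smul]
    have h2 := hzero (-(2 * Real.pi * ξ) : ℝ)
    rw [airyFunctional_apply] at h2
    have h3 (s : ℝ) : Complex.exp (((-2 * Real.pi * s * ξ : ℝ) : ℂ) * Complex.I) • g s
        = Complex.exp (-(2 * Real.pi * ξ) : ℝ) *
          ((1 : Polynomial ℂ).eval (Complex.I * linePoint s) *
            airyExp (-(2 * Real.pi * ξ) : ℝ) (linePoint s)) := by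
      simp only [hg, airyExp, smul_eq_mul, Polynomial.eval_one, one_mul, ← Complex.exp_add]
      congr 1
      simp only [linePoint]
      push_cast
      linear_combination (2 * Real.pi * ξ) * Complex.I_sq
    simp only [h3, integral_const_mul, h2, mul_zero, Pi.zero_apply]
  have h4 := hgc.fourierInv_fourier_eq hgi (by rw [hF]; exact integrable_zero _ _ _)
  have h5 : g 0 = 0 := by
    rw [← h4, hF, Real.fourierInv_eq]
    simp
  exact Complex.exp_ne_zero _ h5

/-- The derivatives of the Airy function at a point satisfy no linear recurrence with constant
coefficients. The polynomials `p` for which `p(d/dx) Ai` vanishes to infinite order at `x` are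
closed under differentiation, because of the commutator of `p(d/dx)` with multiplication by `x` in
the Airy equation, so a nonzero one would lead to a nonzero constant. -/
lemma eq_zero_of_forall_airyFunctional_mul_eq_zero (x : ℂ) (p : Polynomial ℂ)
    (hp : ∀ q, airyFunctional x (p * q) = 0) : p = 0 := by
  induction hn : p.natDegree using Nat.strong_induction_on generalizing p with
  | _ n ih =>
    subst hn
    have hder (q : Polynomial ℂ) : airyFunctional x (Polynomial.derivative p * q) = 0 := by
      have h := airyFunctional_X_sq_mul (p * q) x
      rw [mul_left_comm, hp, hp, Polynomial.derivative_mul, map_add, hp] at h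
      simpa using h.symm
    have hconst : p.natDegree = 0 := by
      by_contra hne
      have h := ih _ (Polynomial.natDegree_derivative_lt hne) _ hder rfl
      exact hne (Polynomial.derivative_eq_zero.1 h)
    obtain ⟨a, rfl⟩ := Polynomial.natDegree_eq_zero.1 hconst
    have h1 := hp 1
    have h2 := hp Polynomial.X
    rw [← Polynomial.smul_eq_C_mul, map_smul, smul_eq_mul] at h1 h2
    rcases airyFunctional_one_or_X_ne_zero x with h | h
    · rw [(mul_eq_zero.1 h1).resolve_right h, map_zero]
    · rw [(mul_eq_zero.1 h2).resolve_right h, map_zero]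

/-- The functional is real on monomials, at real `x`. The symmetry `z ↦ -z̄` of the line
conjugates both `iz` and the exponential. -/
lemma conj_airyFunctional_X_pow (x : ℝ) (k : ℕ) :
    (starRingEnd ℂ) (airyFunctional x (Polynomial.X ^ k)) = airyFunctional x (Polynomial.X ^ k) := by
  rw [airyFunctional_apply, ← integral_conj, ← integral_neg_eq_self]
  congr 1
  ext s
  have h : (starRingEnd ℂ) (linePoint (-s)) = -linePoint s := by
    simp [linePoint]
    ring
  simp only [airyExp, Polynomial.eval_pow, Polynomial.eval_X, map_mul, map_pow, ← Complex.exp_conj,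
    map_add, map_div₀, map_ofNat, Complex.conj_I, Complex.conj_ofReal, h]
  congr 2
  · ring
  · ring

/-- The `k`-th derivative of the Airy function at a real point, multiplied by `2π`. -/
noncomputable def airyDeriv (k : ℕ) (x : ℝ) : ℝ := (airyFunctional x (Polynomial.X ^ k)).re

lemma airyFunctional_X_pow (k : ℕ) (x : ℝ) :
    airyFunctional x (Polynomial.X ^ k) = airyDeriv k x :=
  (Complex.conj_eq_iff_re.1 (conj_airyFunctional_X_pow x k)).symm

lemma hasDerivAt_airyDeriv (k : ℕ) (x : ℝ) : HasDerivAt (airyDeriv k) (airyDeriv (k + 1) x) x := by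
  have h := (hasDerivAt_airyFunctional (Polynomial.X ^ k) x).real_of_complex
  rwa [← pow_succ'] at h

lemma airyDeriv_add_two (k : ℕ) (x : ℝ) :
    airyDeriv (k + 2) x = x * airyDeriv k x + k * airyDeriv (k - 1) x := by
  have h := airyFunctional_X_sq_mul (Polynomial.X ^ k) x
  rw [← pow_add, add_comm, Polynomial.derivative_X_pow, ← Polynomial.smul_eq_C_mul, map_smul,
    airyFunctional_X_pow, airyFunctional_X_pow, airyFunctional_X_pow, smul_eq_mul] at h
  exact_mod_cast h

lemma airyDeriv_zero_or_one_ne_zero (x : ℝ) : airyDeriv 0 x ≠ 0 ∨ airyDeriv 1 x ≠ 0 := by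
  have h := airyFunctional_one_or_X_ne_zero x
  have h0 := airyFunctional_X_pow 0 x
  have h1 := airyFunctional_X_pow 1 x
  rw [pow_zero] at h0
  rw [pow_one] at h1
  rw [h0, h1] at h
  exact_mod_cast h

lemma exists_abs_airyDeriv_le (k : ℕ) : ∃ C, ∀ x, |airyDeriv k x| ≤ C * Real.exp (-x) := by
  refine ⟨∫ s, ‖(Polynomial.X ^ k : Polynomial ℂ).eval (Complex.I * linePoint s)
    * airyExp 0 (linePoint s)‖, fun x => ?_⟩
  refine (Complex.abs_re_le_norm _).trans ((norm_integral_le_integral_norm _).trans_eq ?_)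
  rw [← integral_mul_const]
  congr 1
  ext s
  rw [norm_mul, norm_mul, mul_assoc, airyExp, airyExp, Complex.norm_exp, Complex.norm_exp,
    ← Real.exp_add]
  congr 2
  simp [mul_add, linePoint]

lemma tendsto_airyDeriv_atTop (k : ℕ) : Tendsto (airyDeriv k) atTop (𝓝 0) := by
  obtain ⟨C, h⟩ := exists_abs_airyDeriv_le k
  refine squeeze_zero_norm (fun x => h x) ?_
  simpa using Real.tendsto_exp_neg_atTop_nhds_zero.const_mul C

lemma continuous_airyDeriv (k : ℕ) : Continuous (airyDeriv k) :=
  continuous_iff_continuousAt.2 fun x => (hasDerivAt_airyDeriv k x).continuousAt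

lemma integrableOn_airyDeriv_mul (j k : ℕ) (x : ℝ) :
    IntegrableOn (fun t => airyDeriv j t * airyDeriv k t) (Set.Ioi x) := by
  obtain ⟨C, hC⟩ := exists_abs_airyDeriv_le j
  obtain ⟨D, hD⟩ := exists_abs_airyDeriv_le k
  have hC0 : 0 ≤ C := by simpa using (abs_nonneg _).trans (hC 0)
  refine Integrable.mono' ((integrableOn_exp_mul_Ioi (by norm_num : (-2 : ℝ) < 0) x).const_mul
    (C * D)) ((continuous_airyDeriv j).mul (continuous_airyDeriv k)).aestronglyMeasurable
    (Eventually.of_forall fun t => ?_)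
  rw [Real.norm_eq_abs, abs_mul]
  refine (mul_le_mul (hC t) (hD t) (abs_nonneg _) (by positivity)).trans_eq ?_
  rw [show -2 * t = -t + -t by ring, Real.exp_add]
  ring

/-! ### The Gram matrix of the derivatives -/

/-- The inner product of `Ai^{(j)}` and `Ai^{(k)}` in `L²(x, ∞)`, up to the factor `(2π)²`. -/
noncomputable def airyGram (x : ℝ) (j k : ℕ) : ℝ :=
  ∫ t in Set.Ioi x, airyDeriv j t * airyDeriv k t

/-- The Christoffel–Darboux relation of the Airy kernel, on the level of Taylor coefficients: both
sides have the same derivative in `x` and vanish at `+∞`. -/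
lemma airyGram_christoffel_darboux (x : ℝ) (j k : ℕ) :
    j * airyGram x (j - 1) k - k * airyGram x j (k - 1)
      = airyDeriv j x * airyDeriv (k + 1) x - airyDeriv (j + 1) x * airyDeriv k x := by
  have hder (t : ℝ) : HasDerivAt
      (fun t => airyDeriv (j + 1) t * airyDeriv k t - airyDeriv j t * airyDeriv (k + 1) t)
      (j * (airyDeriv (j - 1) t * airyDeriv k t) - k * (airyDeriv j t * airyDeriv (k - 1) t)) t := by
    refine (((hasDerivAt_airyDeriv (j + 1) t).mul (hasDerivAt_airyDeriv k t)).sub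
      ((hasDerivAt_airyDeriv j t).mul (hasDerivAt_airyDeriv (k + 1) t))).congr_deriv ?_
    rw [add_assoc, add_assoc, airyDeriv_add_two, airyDeriv_add_two]
    ring
  have hlim : Tendsto
      (fun t => airyDeriv (j + 1) t * airyDeriv k t - airyDeriv j t * airyDeriv (k + 1) t)
      atTop (𝓝 0) := by
    simpa using ((tendsto_airyDeriv_atTop (j + 1)).mul (tendsto_airyDeriv_atTop k)).sub
      ((tendsto_airyDeriv_atTop j).mul (tendsto_airyDeriv_atTop (k + 1)))
  have hi1 := (integrableOn_airyDeriv_mul (j - 1) k x).const_mul (j : ℝ)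
  have hi2 := (integrableOn_airyDeriv_mul j (k - 1) x).const_mul (k : ℝ)
  have h := integral_Ioi_of_hasDerivAt_of_tendsto (hder x).continuousAt.continuousWithinAt
    (fun t _ => hder t) (hi1.sub hi2) hlim
  rw [integral_sub hi1 hi2, integral_const_mul, integral_const_mul] at h
  rw [airyGram, airyGram, h]
  ring

lemma eq_zero_of_forall_sum_airyDeriv_eq_zero (x : ℝ) (N : ℕ) (c : ℕ → ℝ)
    (h : ∀ j, ∑ k ∈ Finset.range N, c k * airyDeriv (j + k) x = 0) : ∀ k < N, c k = 0 := by
  have hp := eq_zero_of_forall_airyFunctional_mul_eq_zero x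
    (∑ k ∈ Finset.range N, Polynomial.monomial k (c k : ℂ)) fun q => by
      induction q using Polynomial.induction_on' with
      | add q r hq hr => rw [mul_add, map_add, hq, hr, add_zero]
      | monomial j a =>
        rw [Finset.sum_mul, map_sum]
        calc _ = ∑ k ∈ Finset.range N, (c k : ℂ) * a * (airyDeriv (j + k) x : ℂ) := by
              refine Finset.sum_congr rfl fun k _ => ?_
              rw [Polynomial.monomial_mul_monomial, ← Polynomial.C_mul_X_pow_eq_monomial,
                ← Polynomial.smul_eq_C_mul, map_smul, airyFunctional_X_pow, smul_eq_mul, add_comm k]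
          _ = a * ((∑ k ∈ Finset.range N, c k * airyDeriv (j + k) x : ℝ) : ℂ) := by
              push_cast
              rw [Finset.mul_sum]
              exact Finset.sum_congr rfl fun k _ => by ring
          _ = 0 := by rw [h j, Complex.ofReal_zero, mul_zero]
  intro k hk
  have := congrArg (fun p => Polynomial.coeff p k) hp
  simpa [Polynomial.finsetSum_coeff, Polynomial.coeff_monomial, hk] using this

/-- The Gram matrix is positive definite. A combination of derivatives of norm zero vanishes on
`(x, ∞)`, hence so do all its derivatives. -/
lemma eq_zero_of_sum_airyGram_eq_zero (x : ℝ) (N : ℕ) (c : ℕ → ℝ)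
    (h : ∑ j ∈ Finset.range N, ∑ k ∈ Finset.range N, c j * c k * airyGram x j k = 0) :
    ∀ k < N, c k = 0 := by
  set g : ℕ → ℝ → ℝ := fun j t => ∑ k ∈ Finset.range N, c k * airyDeriv (j + k) t with hg
  have hgd (j : ℕ) (t : ℝ) : HasDerivAt (g j) (g (j + 1) t) t := by
    refine HasDerivAt.fun_sum fun k _ => ?_
    rw [add_right_comm]
    exact (hasDerivAt_airyDeriv (j + k) t).const_mul (c k)
  have hgc : Continuous (g 0) := continuous_iff_continuousAt.2 fun t => (hgd 0 t).continuousAt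
  have hsq (t : ℝ) : g 0 t * g 0 t = ∑ j ∈ Finset.range N, ∑ k ∈ Finset.range N,
      c j * c k * (airyDeriv j t * airyDeriv k t) := by
    simp only [hg, zero_add, Finset.sum_mul_sum]
    exact Finset.sum_congr rfl fun j _ => Finset.sum_congr rfl fun k _ => by ring
  have hint (j k : ℕ) : IntegrableOn (fun t => c j * c k * (airyDeriv j t * airyDeriv k t))
      (Set.Ioi x) := (integrableOn_airyDeriv_mul j k x).const_mul _
  have hgint : IntegrableOn (fun t => g 0 t * g 0 t) (Set.Ioi x) := by
    simp only [hsq]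
    exact integrable_finsetSum _ fun j _ => integrable_finsetSum _ fun k _ => hint j k
  have hzero : ∫ t in Set.Ioi x, g 0 t * g 0 t = 0 := by
    simp only [hsq]
    rw [integral_finsetSum _ fun j _ => integrable_finsetSum _ fun k _ => hint j k, ← h]
    refine Finset.sum_congr rfl fun j _ => ?_
    rw [integral_finsetSum _ fun k _ => hint j k]
    exact Finset.sum_congr rfl fun k _ => integral_const_mul _ _
  have hae := (setIntegral_eq_zero_iff_of_nonneg_ae
    (Eventually.of_forall fun t => mul_self_nonneg (g 0 t)) hgint).1 hzero
  have hz := Measure.eqOn_open_of_ae_eq hae isOpen_Ioi (hgc.mul hgc).continuousOn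
    continuousOn_const
  have hall (j : ℕ) : ∀ t ∈ Set.Ioi x, g j t = 0 := by
    induction j with
    | zero => exact fun t ht => mul_self_eq_zero.1 (hz ht)
    | succ j ih =>
      intro t ht
      refine (hgd j t).unique ((hasDerivAt_const t (0 : ℝ)).congr_of_eventuallyEq ?_)
      filter_upwards [isOpen_Ioi.mem_nhds ht] with s hs using ih s hs
  exact eq_zero_of_forall_sum_airyDeriv_eq_zero (x + 1) N c
    fun j => hall j (x + 1) (by simp)

/-! ### Padé approximation of a quotient with a definite kernel -/

/-- If `(u - v) K(u, v) = φ(u) ψ(v) - ψ(u) φ(v)` and `A φ + B ψ = O(u^{2m+2})` with `A`, `B` of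
degree at most `m` and `ψ(0) ≠ 0`, then the coefficient of `u^m v^m` in `a(u) a(v) K(u, v)`, where
`a = A / ψ`, is zero. Modulo `u^{2m+2}` and `v^{2m+2}`, `(u - v) a(u) a(v) K(u, v)` is the
Bezoutian numerator `A(u) B(v) - B(u) A(v)`. A series in `u` and `v` is written as a series
in `u` over the ring of series in `v`. -/
lemma coeff_coeff_mul_kernel_eq_zero {F : Type*} [Field F] (m : ℕ) (φ ψ A B : PowerSeries F)
    (K : PowerSeries (PowerSeries F))
    (hK : (PowerSeries.X - PowerSeries.C PowerSeries.X) * K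
      = PowerSeries.map PowerSeries.C φ * PowerSeries.C ψ
        - PowerSeries.map PowerSeries.C ψ * PowerSeries.C φ)
    (hψ : PowerSeries.constantCoeff ψ ≠ 0)
    (hA : ∀ j, m < j → PowerSeries.coeff j A = 0) (hB : ∀ j, m < j → PowerSeries.coeff j B = 0)
    (hF : ∀ j < 2 * m + 2, PowerSeries.coeff j (A * φ + B * ψ) = 0) :
    PowerSeries.coeff m (PowerSeries.coeff m (PowerSeries.map PowerSeries.C (A * ψ⁻¹) *
      (PowerSeries.C (A * ψ⁻¹) * K))) = 0 := by
  set R : PowerSeries F := (A * φ + B * ψ) * ψ⁻¹ with hR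
  set G := PowerSeries.map PowerSeries.C (A * ψ⁻¹) * (PowerSeries.C (A * ψ⁻¹) * K) with hG
  have hinv : ψ * ψ⁻¹ = 1 := PowerSeries.mul_inv_cancel ψ hψ
  have hRcoeff : ∀ j < 2 * m + 2, PowerSeries.coeff j R = 0 := by
    intro j hj
    rw [hR, PowerSeries.coeff_mul]
    refine Finset.sum_eq_zero fun p hp => ?_
    rw [hF p.1 (by have := Finset.HasAntidiagonal.mem_antidiagonal.1 hp; lia), zero_mul]
  have hAφ : A * ψ⁻¹ * φ = R - B := by
    rw [hR]; linear_combination (-B) * hinv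
  have hAψ : A * ψ⁻¹ * ψ = A := by linear_combination A * hinv
  have hGeq : (PowerSeries.X - PowerSeries.C PowerSeries.X) * G
      = PowerSeries.map PowerSeries.C (R - B) * PowerSeries.C A
        - PowerSeries.map PowerSeries.C A * PowerSeries.C (R - B) := by
    calc _ = PowerSeries.map PowerSeries.C (A * ψ⁻¹) * PowerSeries.C (A * ψ⁻¹) *
          ((PowerSeries.X - PowerSeries.C PowerSeries.X) * K) := by rw [hG]; ring
      _ = PowerSeries.map PowerSeries.C (A * ψ⁻¹ * φ) * PowerSeries.C (A * ψ⁻¹ * ψ)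
          - PowerSeries.map PowerSeries.C (A * ψ⁻¹ * ψ) * PowerSeries.C (A * ψ⁻¹ * φ) := by
        rw [hK]; simp only [map_mul]; ring
      _ = _ := by rw [hAφ, hAψ]
  -- the coefficient of `u^(m+1+i) v^k` of the identity moves one step along the antidiagonal
  have hstep (i k : ℕ) (hi : i ≤ m) :
      PowerSeries.coeff k (PowerSeries.coeff (m + i) G)
        = PowerSeries.coeff k (PowerSeries.X * PowerSeries.coeff (m + i + 1) G) := by
    have h := congrArg (fun S => PowerSeries.coeff k (PowerSeries.coeff (m + i + 1) S)) hGeq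
    simp only [sub_mul, mul_sub, map_sub, PowerSeries.coeff_succ_X_mul, PowerSeries.coeff_C_mul,
      PowerSeries.coeff_mul_C, PowerSeries.coeff_map, hA (m + i + 1) (by lia),
      hB (m + i + 1) (by lia), hRcoeff (m + i + 1) (by lia), map_zero, zero_mul, sub_zero] at h
    exact sub_eq_zero.1 h
  have hdiag (i : ℕ) (hi : i ≤ m) : PowerSeries.coeff (m - i) (PowerSeries.coeff (m + i) G)
      = PowerSeries.coeff m (PowerSeries.coeff m G) := by
    induction i with
    | zero => simp
    | succ i ih =>
      rw [← ih (by lia), hstep i _ (by lia), show m - i = m - (i + 1) + 1 by lia,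
        PowerSeries.coeff_succ_X_mul, add_assoc]
  rw [← hdiag m le_rfl, hstep m _ le_rfl, Nat.sub_self, PowerSeries.coeff_zero_X_mul]

/-- The case `ψ(0) ≠ 0` of `eq_zero_of_definite_kernel`: the vanishing coefficient of
`a(u) a(v) K(u, v)` is the quadratic form of `κ` at the reversed coefficients of `a = A / ψ`. -/
lemma eq_zero_of_definite_kernel_of_ne_zero {F : Type*} [Field F] (m : ℕ) (φ ψ A B : PowerSeries F)
    (κ : ℕ → ℕ → F)
    (hK : (PowerSeries.X - PowerSeries.C PowerSeries.X) *
        PowerSeries.mk (fun j => PowerSeries.mk (κ j))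
      = PowerSeries.map PowerSeries.C φ * PowerSeries.C ψ
        - PowerSeries.map PowerSeries.C ψ * PowerSeries.C φ)
    (hdef : ∀ c : ℕ → F, ∑ j ∈ Finset.range (m + 1), ∑ k ∈ Finset.range (m + 1),
      c j * c k * κ j k = 0 → ∀ k < m + 1, c k = 0)
    (hψ : PowerSeries.constantCoeff ψ ≠ 0)
    (hA : ∀ j, m < j → PowerSeries.coeff j A = 0) (hB : ∀ j, m < j → PowerSeries.coeff j B = 0)
    (hF : ∀ j < 2 * m + 2, PowerSeries.coeff j (A * φ + B * ψ) = 0) :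
    A = 0 ∧ B = 0 := by
  have hinv : ψ * ψ⁻¹ = 1 := PowerSeries.mul_inv_cancel ψ hψ
  have h0 := coeff_coeff_mul_kernel_eq_zero m φ ψ A B _ hK hψ hA hB hF
  set a := A * ψ⁻¹ with ha
  have hc := hdef (fun j => PowerSeries.coeff (m - j) a) (by
    rw [← h0]
    rw [PowerSeries.coeff_mul]
    simp only [PowerSeries.coeff_map, map_sum, PowerSeries.coeff_C_mul, PowerSeries.coeff_mk]
    simp only [PowerSeries.coeff_mul, PowerSeries.coeff_mk]
    rw [Finset.Nat.sum_antidiagonal_eq_sum_range_succ_mk, ← Finset.sum_range_reflect]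
    refine Finset.sum_congr rfl fun j hj => ?_
    rw [Finset.mem_range] at hj
    rw [Finset.Nat.sum_antidiagonal_eq_sum_range_succ_mk, Finset.mul_sum,
      ← Finset.sum_range_reflect]
    refine Finset.sum_congr rfl fun k hk => ?_
    rw [Finset.mem_range] at hk
    simp only [Nat.add_sub_cancel]
    rw [show m - (m - j) = j by lia, show m - (m - k) = k by lia]
    ring)
  have hacoeff : ∀ j < m + 1, PowerSeries.coeff j a = 0 := by
    intro j hj
    have := hc (m - j) (by lia)
    rwa [show m - (m - j) = j by lia] at this
  have hA0 : A = 0 := by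
    ext j
    rw [map_zero]
    by_cases hj : m < j
    · exact hA j hj
    · have : A = a * ψ := by rw [ha]; linear_combination (-A) * hinv
      rw [this, PowerSeries.coeff_mul]
      refine Finset.sum_eq_zero fun p hp => ?_
      rw [hacoeff p.1 (by have := Finset.HasAntidiagonal.mem_antidiagonal.1 hp; lia), zero_mul]
  refine ⟨hA0, ?_⟩
  ext j
  rw [map_zero]
  by_cases hj : m < j
  · exact hB j hj
  · have : B = (A * φ + B * ψ) * ψ⁻¹ := by rw [hA0]; linear_combination (-B) * hinv
    rw [this, PowerSeries.coeff_mul]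
    refine Finset.sum_eq_zero fun p hp => ?_
    rw [hF p.1 (by have := Finset.HasAntidiagonal.mem_antidiagonal.1 hp; lia), zero_mul]

/-- If the quadratic form of `K(u, v) = (φ(u) ψ(v) - ψ(u) φ(v)) / (u - v)` on the coefficients up to
order `m` is definite, there is no nonzero pair `(A, B)` of polynomials of degree at most `m` with
`A φ + B ψ = O(u^{2m+2})`. -/
lemma eq_zero_of_definite_kernel {F : Type*} [Field F] (m : ℕ) (φ ψ A B : PowerSeries F)
    (κ : ℕ → ℕ → F)
    (hK : (PowerSeries.X - PowerSeries.C PowerSeries.X) *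
        PowerSeries.mk (fun j => PowerSeries.mk (κ j))
      = PowerSeries.map PowerSeries.C φ * PowerSeries.C ψ
        - PowerSeries.map PowerSeries.C ψ * PowerSeries.C φ)
    (hdef : ∀ c : ℕ → F, ∑ j ∈ Finset.range (m + 1), ∑ k ∈ Finset.range (m + 1),
      c j * c k * κ j k = 0 → ∀ k < m + 1, c k = 0)
    (hφψ : PowerSeries.constantCoeff φ ≠ 0 ∨ PowerSeries.constantCoeff ψ ≠ 0)
    (hA : ∀ j, m < j → PowerSeries.coeff j A = 0) (hB : ∀ j, m < j → PowerSeries.coeff j B = 0)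
    (hF : ∀ j < 2 * m + 2, PowerSeries.coeff j (A * φ + B * ψ) = 0) :
    A = 0 ∧ B = 0 := by
  rcases hφψ with hφ | hψ
  · refine (eq_zero_of_definite_kernel_of_ne_zero m ψ φ B A (fun j k => -κ j k) ?_ ?_ hφ hB hA ?_).symm
    · have : PowerSeries.mk (fun j => PowerSeries.mk fun k => -κ j k)
          = -PowerSeries.mk (fun j => PowerSeries.mk (κ j)) := by
        ext j k
        simp
      rw [this, mul_neg, hK]
      ring
    · intro c hc
      refine hdef c ?_
      simpa only [mul_neg, Finset.sum_neg_distrib, neg_eq_zero] using hc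
    · simpa only [add_comm] using hF
  · exact eq_zero_of_definite_kernel_of_ne_zero m φ ψ A B κ hK hdef hψ hA hB hF

/-! ### The Hankel matrix of derivatives of the Airy function -/

/-- The Taylor series of `Ai^{(k)}` at `x`, up to the factor `2π`. -/
noncomputable def airySeries (x : ℝ) (k : ℕ) : PowerSeries ℝ :=
  PowerSeries.mk fun j => airyDeriv (j + k) x / j.factorial

lemma derivative_airySeries (x : ℝ) (k : ℕ) :
    PowerSeries.derivative ℝ (airySeries x k) = airySeries x (k + 1) := by
  ext j
  rw [PowerSeries.coeff_derivative, airySeries, airySeries, PowerSeries.coeff_mk,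
    PowerSeries.coeff_mk, Nat.factorial_succ, show j + 1 + k = j + (k + 1) by ring]
  push_cast
  field_simp

lemma airySeries_two (x : ℝ) :
    airySeries x 2 = (PowerSeries.C x + PowerSeries.X) * airySeries x 0 := by
  ext j
  rw [add_mul, map_add, PowerSeries.coeff_C_mul, airySeries, airySeries, PowerSeries.coeff_mk,
    PowerSeries.coeff_mk, airyDeriv_add_two]
  cases j with
  | zero => simp
  | succ j =>
    rw [PowerSeries.coeff_succ_X_mul, PowerSeries.coeff_mk, Nat.factorial_succ]
    simp only [Nat.add_sub_cancel, add_zero]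
    push_cast
    field_simp

/-- `Ai^{(k)} = a Ai + b Ai'` with polynomials `a`, `b` of degrees at most `k / 2` and
`(k - 1) / 2`. -/
lemma exists_airySeries_eq (x : ℝ) (k : ℕ) : ∃ a b : PowerSeries ℝ,
    airySeries x k = a * airySeries x 0 + b * airySeries x 1 ∧
      (∀ j, k < 2 * j → PowerSeries.coeff j a = 0) ∧
      ∀ j, k < 2 * j + 1 → PowerSeries.coeff j b = 0 := by
  induction k with
  | zero =>
    refine ⟨1, 0, by simp, fun j hj => ?_, by simp⟩
    rw [PowerSeries.coeff_one, if_neg (by lia)]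
  | succ k ih =>
    obtain ⟨a, b, h, ha, hb⟩ := ih
    refine ⟨PowerSeries.derivative ℝ a + (PowerSeries.C x + PowerSeries.X) * b,
      a + PowerSeries.derivative ℝ b, ?_, fun j hj => ?_, fun j hj => ?_⟩
    · rw [← derivative_airySeries, h, map_add, Derivation.leibniz, Derivation.leibniz,
        derivative_airySeries, derivative_airySeries, airySeries_two]
      simp only [smul_eq_mul]
      ring
    · rw [map_add, PowerSeries.coeff_derivative, ha (j + 1) (by lia), add_mul, map_add,
        PowerSeries.coeff_C_mul, hb j (by lia)]
      obtain ⟨i, rfl⟩ : ∃ i, j = i + 1 := ⟨j - 1, by lia⟩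
      rw [PowerSeries.coeff_succ_X_mul, hb i (by lia)]
      ring
    · rw [map_add, PowerSeries.coeff_derivative, ha j (by lia), hb (j + 1) (by lia)]
      ring

/-- The Christoffel–Darboux formula for the Airy kernel `∫_x^∞ Ai(t + u) Ai(t + v) dt`, as an identity
of Taylor series in `u` and `v`. -/
lemma airyKernel_series_eq (x : ℝ) :
    (PowerSeries.X - PowerSeries.C PowerSeries.X) *
        PowerSeries.mk (fun j => PowerSeries.mk fun k =>
          airyGram x j k / (j.factorial * k.factorial))
      = PowerSeries.map PowerSeries.C (airySeries x 0) * PowerSeries.C (airySeries x 1)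
        - PowerSeries.map PowerSeries.C (airySeries x 1) * PowerSeries.C (airySeries x 0) := by
  ext j k
  have h := airyGram_christoffel_darboux x j k
  simp only [sub_mul, map_sub, PowerSeries.coeff_C_mul, PowerSeries.coeff_mul_C,
    PowerSeries.coeff_map, airySeries, PowerSeries.coeff_mk, add_zero]
  have hrhs : airyDeriv j x / j.factorial * (airyDeriv (k + 1) x / k.factorial)
      - airyDeriv (j + 1) x / j.factorial * (airyDeriv k x / k.factorial)
      = (j * airyGram x (j - 1) k - k * airyGram x j (k - 1)) / (j.factorial * k.factorial) := by
    rw [h]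
    field_simp
  rw [hrhs, sub_div]
  congr 1
  · cases j with
    | zero => simp
    | succ j =>
      rw [PowerSeries.coeff_succ_X_mul, PowerSeries.coeff_mk, PowerSeries.coeff_mk,
        Nat.factorial_succ, Nat.add_sub_cancel]
      push_cast
      field_simp
  · cases k with
    | zero => simp
    | succ k =>
      rw [PowerSeries.coeff_succ_X_mul, PowerSeries.coeff_mk, Nat.factorial_succ,
        Nat.add_sub_cancel]
      push_cast
      field_simp

/-- The even-sized Hankel matrices of the derivatives of the Airy function have trivial kernel. A
kernel vector `p` gives a combination of the Taylor series `Ai^{(k)}`, `k < 2n`, that vanishes to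
order `2n`; written as `A Ai + B Ai'` it is a Padé pair of degree less than `n`. -/
lemma airyHankel_kernel (x : ℝ) (n : ℕ) (p : ℕ → ℝ)
    (hp : ∀ j < 2 * n, ∑ k ∈ Finset.range (2 * n), p k * airyDeriv (j + k) x = 0) :
    ∀ k < 2 * n, p k = 0 := by
  obtain _ | m := n
  · simp
  choose a b hab ha hb using exists_airySeries_eq x
  set A := ∑ k ∈ Finset.range (2 * (m + 1)), PowerSeries.C (p k) * a k with hA
  set B := ∑ k ∈ Finset.range (2 * (m + 1)), PowerSeries.C (p k) * b k with hB
  have hsum : A * airySeries x 0 + B * airySeries x 1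
      = ∑ k ∈ Finset.range (2 * (m + 1)), PowerSeries.C (p k) * airySeries x k := by
    rw [hA, hB, Finset.sum_mul, Finset.sum_mul, ← Finset.sum_add_distrib]
    refine Finset.sum_congr rfl fun k _ => ?_
    rw [hab k]
    ring
  have hcoeff (j : ℕ) : PowerSeries.coeff j (A * airySeries x 0 + B * airySeries x 1)
      = (∑ k ∈ Finset.range (2 * (m + 1)), p k * airyDeriv (j + k) x) / j.factorial := by
    rw [hsum, map_sum, Finset.sum_div]
    refine Finset.sum_congr rfl fun k _ => ?_
    rw [PowerSeries.coeff_C_mul, airySeries, PowerSeries.coeff_mk, mul_div_assoc]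
  obtain ⟨hA0, hB0⟩ := eq_zero_of_definite_kernel m (airySeries x 0) (airySeries x 1) A B
    (fun j k => airyGram x j k / (j.factorial * k.factorial)) (airyKernel_series_eq x)
    (fun c hc => by
      have h := eq_zero_of_sum_airyGram_eq_zero x (m + 1) (fun j => c j / j.factorial) (by
        rw [← hc]
        refine Finset.sum_congr rfl fun j _ => Finset.sum_congr rfl fun k _ => ?_
        field_simp)
      intro k hk
      exact (div_eq_zero_iff.1 (h k hk)).resolve_right (by positivity))
    (by simpa [airySeries, ← PowerSeries.coeff_zero_eq_constantCoeff_apply]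
      using airyDeriv_zero_or_one_ne_zero x)
    (fun j hj => by
      rw [hA, map_sum]
      refine Finset.sum_eq_zero fun k hk => ?_
      rw [PowerSeries.coeff_C_mul, ha k j (by have := Finset.mem_range.1 hk; lia), mul_zero])
    (fun j hj => by
      rw [hB, map_sum]
      refine Finset.sum_eq_zero fun k hk => ?_
      rw [PowerSeries.coeff_C_mul, hb k j (by have := Finset.mem_range.1 hk; lia), mul_zero])
    (fun j hj => by rw [hcoeff, hp j (by lia), zero_div])
  refine eq_zero_of_forall_sum_airyDeriv_eq_zero x _ p fun j => ?_
  have h := hcoeff j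
  rw [hA0, hB0, zero_mul, zero_mul, add_zero, map_zero] at h
  exact (div_eq_zero_iff.1 h.symm).resolve_right (by positivity)

/-! ### Orthogonal polynomials from a nonzero Hankel determinant -/

/-- A linear functional on polynomials whose `N`-th Hankel determinant is nonzero has exactly one
monic orthogonal polynomial of degree `N`. -/
lemma existsUnique_monic_orthogonal {F : Type*} [Field F] (L : Polynomial F →ₗ[F] F) (N : ℕ)
    (hdet : (Matrix.of fun j k : Fin N => L (Polynomial.X ^ ((j : ℕ) + k))).det ≠ 0) :
    ∃! p : Polynomial F, p.Monic ∧ p.natDegree = N ∧ ∀ k < N, L (p * Polynomial.X ^ k) = 0 := by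
  set M := Matrix.of fun j k : Fin N => L (Polynomial.X ^ ((j : ℕ) + k)) with hM
  have hMv (v : Fin N → F) (j : Fin N) : M.mulVec v j
      = L ((∑ k : Fin N, Polynomial.C (v k) * Polynomial.X ^ (k : ℕ)) * Polynomial.X ^ (j : ℕ)) := by
    rw [Finset.sum_mul, map_sum, Matrix.mulVec, dotProduct]
    refine Finset.sum_congr rfl fun k _ => ?_
    rw [mul_assoc, ← pow_add, ← Polynomial.smul_eq_C_mul, map_smul, smul_eq_mul, hM,
      Matrix.of_apply, add_comm (k : ℕ), mul_comm]
  refine existsUnique_of_exists_of_unique ?_ ?_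
  · set w : Fin N → F := fun j => -L (Polynomial.X ^ (N + (j : ℕ)))
    have hv : M.mulVec (M⁻¹.mulVec w) = w := by
      rw [Matrix.mulVec_mulVec, Matrix.mul_nonsing_inv _ (isUnit_iff_ne_zero.2 hdet),
        Matrix.one_mulVec]
    refine ⟨Polynomial.X ^ N + ∑ k : Fin N, Polynomial.C (M⁻¹.mulVec w k) * Polynomial.X ^ (k : ℕ),
      Polynomial.monic_X_pow_add (Polynomial.degree_sum_fin_lt _), ?_, fun k hk => ?_⟩
    · refine Polynomial.natDegree_eq_of_degree_eq_some ?_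
      rw [Polynomial.degree_add_eq_left_of_degree_lt] <;> rw [Polynomial.degree_X_pow]
      exact Polynomial.degree_sum_fin_lt _
    · have h := congrFun hv ⟨k, hk⟩
      rw [hMv] at h
      rw [add_mul, map_add, ← pow_add, h]
      exact add_neg_cancel _
  · rintro p q ⟨hp, hpd, hpo⟩ ⟨hq, hqd, hqo⟩
    have hlt : (p - q).degree < N := by
      have hpq : p.degree = q.degree := by
        rw [Polynomial.degree_eq_natDegree hp.ne_zero, Polynomial.degree_eq_natDegree hq.ne_zero,
          hpd, hqd]
      have h := Polynomial.degree_sub_lt_left hpq hp.ne_zero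
        (hp.leadingCoeff.trans hq.leadingCoeff.symm)
      rwa [Polynomial.degree_eq_natDegree hp.ne_zero, hpd] at h
    have hrep : p - q = ∑ k : Fin N, Polynomial.C ((p - q).coeff k) * Polynomial.X ^ (k : ℕ) := by
      rw [Fin.sum_univ_eq_sum_range fun k => Polynomial.C ((p - q).coeff k) * Polynomial.X ^ k]
      by_cases h0 : p - q = 0
      · simp [h0]
      · exact (p - q).as_sum_range_C_mul_X_pow' ((Polynomial.natDegree_lt_iff_degree_lt h0).2 hlt)
    have hker : M.mulVec (fun k : Fin N => (p - q).coeff k) = 0 := by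
      ext j
      rw [hMv, ← hrep, sub_mul, map_sub, hpo j j.2, hqo j j.2, sub_zero, Pi.zero_apply]
    have hzero : (fun k : Fin N => (p - q).coeff k) = 0 := by
      by_contra hne
      exact hdet (Matrix.exists_mulVec_eq_zero_iff.1 ⟨_, hne, hker⟩)
    rw [← sub_eq_zero, hrep]
    refine Finset.sum_eq_zero fun k _ => ?_
    have := congrFun hzero k
    simp only [Pi.zero_apply] at this
    rw [this, map_zero, zero_mul]

/-! ### The moments along the contour -/

/-- The linear functional `P ↦ ∫_γ P(z) e^{i (z³/3 - δ z)} dz`. -/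
noncomputable def momentFunctional (δ : ℝ) : Polynomial ℂ →ₗ[ℂ] ℂ :=
  (airyFunctional (-δ : ℝ)).comp
    (Polynomial.aeval (Polynomial.C (-Complex.I) * Polynomial.X)).toLinearMap

lemma momentFunctional_X_pow (δ : ℝ) (k : ℕ) :
    momentFunctional δ (Polynomial.X ^ k) = (-Complex.I) ^ k * airyDeriv k (-δ) := by
  have h : momentFunctional δ (Polynomial.X ^ k)
      = airyFunctional (-δ : ℝ) ((-Complex.I) ^ k • Polynomial.X ^ k) := by
    rw [momentFunctional, LinearMap.comp_apply, AlgHom.toLinearMap_apply, map_pow,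
      Polynomial.aeval_X, mul_pow, ← map_pow, Polynomial.smul_eq_C_mul]
  rw [h, map_smul, airyFunctional_X_pow, smul_eq_mul]

lemma hasContourIntegral_eval_mul_airyWeight {γ : ℝ → ℂ} (hγ : IsAiryContour γ) (δ : ℝ)
    (P : Polynomial ℂ) :
    HasContourIntegral γ (fun z => P.eval z * airyWeight δ z) (momentFunctional δ P) := by
  have h := hasContourIntegral_eval_mul_airyExp hγ P (-δ : ℝ)
  simp only [airyWeight_eq_airyExp]
  convert h using 1
  rw [momentFunctional, LinearMap.comp_apply, airyFunctional_apply]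
  congr 1
  ext s
  rw [AlgHom.toLinearMap_apply, ← Polynomial.comp_eq_aeval, Polynomial.eval_comp,
    Polynomial.eval_mul, Polynomial.eval_C, Polynomial.eval_X, ← mul_assoc, neg_mul,
    Complex.I_mul_I, neg_neg, one_mul]

lemma airyMoment_eq {γ : ℝ → ℂ} (hγ : IsAiryContour γ) (δ : ℝ) (k : ℕ) :
    airyMoment γ δ k = momentFunctional δ (Polynomial.X ^ k) := by
  have h := hasContourIntegral_eval_mul_airyWeight hγ δ (Polynomial.X ^ k)
  simp only [Polynomial.eval_pow, Polynomial.eval_X] at h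
  exact h.limUnder_eq

/-- The phases `(-i)^(j+k)` of the moments can be absorbed into the rows and columns, which leaves
the real Hankel matrix of derivatives of the Airy function. -/
lemma det_momentFunctional_ne_zero (δ : ℝ) (n : ℕ) :
    (Matrix.of fun j k : Fin (2 * n) =>
      momentFunctional δ (Polynomial.X ^ ((j : ℕ) + k))).det ≠ 0 := by
  intro hdet
  obtain ⟨v, hv0, hv⟩ := Matrix.exists_mulVec_eq_zero_iff.2 hdet
  have hI (k : ℕ) : (-Complex.I) ^ k ≠ 0 := pow_ne_zero _ (neg_ne_zero.2 Complex.I_ne_zero)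
  set u : ℕ → ℂ := fun k => if h : k < 2 * n then (-Complex.I) ^ k * v ⟨k, h⟩ else 0 with hu
  have hker : ∀ j < 2 * n, ∑ k ∈ Finset.range (2 * n), (airyDeriv (j + k) (-δ) : ℂ) * u k = 0 := by
    intro j hj
    have h := congrFun hv ⟨j, hj⟩
    simp only [Matrix.mulVec, dotProduct, Matrix.of_apply, momentFunctional_X_pow,
      Pi.zero_apply] at h
    refine (mul_eq_zero.1 ?_).resolve_left (hI j)
    rw [Finset.mul_sum, Finset.sum_range, ← h]
    refine Finset.sum_congr rfl fun k _ => ?_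
    simp only [hu, k.2, dif_pos, Fin.eta]
    ring
  have hre := airyHankel_kernel (-δ) n (fun k => (u k).re) fun j hj => by
    have h := congrArg Complex.re (hker j hj)
    simpa [Complex.re_sum, Complex.re_ofReal_mul, mul_comm] using h
  have him := airyHankel_kernel (-δ) n (fun k => (u k).im) fun j hj => by
    have h := congrArg Complex.im (hker j hj)
    simpa [Complex.im_sum, Complex.im_ofReal_mul, mul_comm] using h
  refine hv0 (funext fun k => ?_)
  have h : u k = 0 := Complex.ext (hre k k.2) (him k k.2)
  simp only [hu, k.2, dif_pos, Fin.eta] at h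
  exact (mul_eq_zero.1 h).resolve_left (hI k)

theorem theorem1 (γ : ℝ → ℂ) (hγ : IsAiryContour γ) (n : ℕ) (δ : ℝ) :
    (∀ k : ℕ, HasContourIntegral γ (fun z => z ^ k * airyWeight δ z) (airyMoment γ δ k)) ∧
      airyHankelDet γ δ (2 * n) ≠ 0 ∧
      ∃! p : Polynomial ℂ, IsMonicOrthogonal γ δ (2 * n) p := by
  refine ⟨fun k => ?_, ?_, ?_⟩
  · have h := hasContourIntegral_eval_mul_airyWeight hγ δ (Polynomial.X ^ k)
    simp only [Polynomial.eval_pow, Polynomial.eval_X] at h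
    rwa [airyMoment_eq hγ]
  · simp only [airyHankelDet, airyHankelMatrix, airyMoment_eq hγ]
    exact det_momentFunctional_ne_zero δ n
  · have hiff (p : Polynomial ℂ) (k : ℕ) :
        HasContourIntegral γ (fun z => p.eval z * z ^ k * airyWeight δ z) 0
          ↔ momentFunctional δ (p * Polynomial.X ^ k) = 0 := by
      have h := hasContourIntegral_eval_mul_airyWeight hγ δ (p * Polynomial.X ^ k)
      simp only [Polynomial.eval_mul, Polynomial.eval_pow, Polynomial.eval_X] at h
      exact ⟨fun h0 => tendsto_nhds_unique h h0, fun h0 => h0 ▸ h⟩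
    simp only [IsMonicOrthogonal, hiff]
    exact existsUnique_monic_orthogonal _ _ (det_momentFunctional_ne_zero δ n)
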